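/- Let $n\ge 1$ and equip $\mathbb{R}^{2n}=\mathbb{R}^n_x\times\mathbb{R}^n_p$ with the Euclidean norm, Lebesgue measure and the standard symplectic form $\omega((x,p),(x',p'))=p\cdot x'-p'\cdot x$. Let $\operatorname{Sp}(n)$ be the group of linear automorphisms of $\mathbb{R}^{2n}$ preserving $\omega$, and let $B^{2n}(z_0,R)$ be the closed ball with center $z_0$ and radius $R$, with $B^{2n}(R)=B^{2n}(0,R)$. A Lagrangian plane is an $n$-dimensional subspace of $\mathbb{R}^{2n}$ on which $\omega$ vanishes. Let $\ell,\ell'$ be Lagrangian planes with $\ell\cap\ell'=0$, and let $X_\ell\subset\ell$ be a centered ellipsoid, i.e. $X_\ell=\{z\in\ell: Q(z)\le 1\}$ for a positive definite quadratic form $Q$ on $\ell$. Let $$X_{\ell'}^{o}=\{z'\in\ell' : \omega(z,z')\le 1 \text{ for all } z\in X_\ell\}$$ be its Lagrangian polar dual, and regard $X_\ell\times X_{\ell'}^o$ as the subset $\{z+z' : z\in X_\ell,\ z'\in X_{\ell'}^o\}$ of $\ell\oplus\ell'=\mathbb{R}^{2n}$. Then: (i) There exists $S\in\operatorname{Sp}(n)$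 such that $S(B^{2n}(1))$ is the John ellipsoid of $X_\ell\times X_{\ell'}^o$, that is, the unique ellipsoid of maximal volume among all ellipsoids (with arbitrary center) contained in $X_\ell\times X_{\ell'}^o$. (ii) The minimal linear symplectic capacity, defined for $\Omega\subset\mathbb{R}^{2n}$ by $$c_{\min}^{\mathrm{lin}}(\Omega)=\sup\{\pi R^2 : R\ge 0,\ S(B^{2n}(z_0,R))\subset\Omega \text{ for some } S\in\operatorname{Sp}(n),\ z_0\in\mathbb{R}^{2n}\}\in[0,\infty],$$ satisfies $c_{\min}^{\mathrm{lin}}(X_\ell\times X_{\ell'}^o)=\pi$. -/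

import Mathlib

open scoped ENNReal

namespace LagrangianPolarity

/-- The phase space `ℝ²ⁿ` with its Euclidean structure and Lebesgue measure. A point is
`z = (x, p)`; its coordinates are `x j = z (Sum.inl j)` and `p j = z (Sum.inr j)`. -/
abbrev PhaseSpace (n : ℕ) : Type := EuclideanSpace ℝ (Fin n ⊕ Fin n)

/-- The standard symplectic form `ω = ∑ j, dp_j ∧ dx_j`, that is
`ω((x, p), (x', p')) = p · x' - p' · x`. -/
def omega {n : ℕ} (z z' : PhaseSpace n) : ℝ :=
  ∑ j : Fin n, (z (Sum.inr j) * z' (Sum.inl j) - z' (Sum.inr j) * z (Sum.inl j))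

/-- The symplectic group `Sp(n)`: the linear automorphisms of `ℝ²ⁿ` that preserve `ω`. -/
def Sp (n : ℕ) : Subgroup (PhaseSpace n ≃ₗ[ℝ] PhaseSpace n) where
  carrier := {S | ∀ z z' : PhaseSpace n, omega (S z) (S z') = omega z z'}
  one_mem' := fun _ _ => rfl
  mul_mem' := by
    intro S T hS hT z z'
    exact (hS (T z) (T z')).trans (hT z z')
  inv_mem' := by
    intro S hS z z'
    have h := hS (S.symm z) (S.symm z')
    rw [S.apply_symm_apply, S.apply_symm_apply] at h
    exact h.symm

/-- A Lagrangian plane: an `n`-dimensional subspace of `ℝ²ⁿ` on which `ω` vanishes. -/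
def IsLagrangianPlane {n : ℕ} (l : Submodule ℝ (PhaseSpace n)) : Prop :=
  Module.finrank ℝ l = n ∧ ∀ z ∈ l, ∀ z' ∈ l, omega z z' = 0

/-- Transversality of two planes: `ℓ ∩ ℓ' = 0`. -/
def AreTransverse {n : ℕ} (l l' : Submodule ℝ (PhaseSpace n)) : Prop :=
  l ⊓ l' = ⊥

/-- A (nondegenerate, solid) ellipsoid centered at the origin of a real vector space:
`{z | Q z ≤ 1}` for a positive definite quadratic form `Q`. -/
def IsCenteredEllipsoid {V : Type*} [AddCommGroup V] [Module ℝ V] (X : Set V) : Prop :=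
  ∃ Q : QuadraticForm ℝ V, Q.PosDef ∧ X = {z | Q z ≤ 1}

/-- A (nondegenerate, solid) ellipsoid with an arbitrary center `c`. -/
def IsEllipsoid {V : Type*} [AddCommGroup V] [Module ℝ V] (E : Set V) : Prop :=
  ∃ (c : V) (Q : QuadraticForm ℝ V), Q.PosDef ∧ E = {z | Q (z - c) ≤ 1}

/-- The Lagrangian polar dual in `ℓ'` of a subset `X` of `ℓ`: all `z' ∈ ℓ'` such that
`ω(z, z') ≤ 1` for all `z ∈ X`. -/
def lagrangianPolarDual {n : ℕ} {l : Submodule ℝ (PhaseSpace n)} (X : Set l)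
    (l' : Submodule ℝ (PhaseSpace n)) : Set l' :=
  {z' | ∀ z ∈ X, omega (z : PhaseSpace n) (z' : PhaseSpace n) ≤ 1}

/-- The product `X × Y` of `X ⊆ ℓ` and `Y ⊆ ℓ'`, as a subset of `ℝ²ⁿ`, where `(x, y)` is
identified with `x + y` (so that `ℓ × ℓ'` is `ℝ²ⁿ = ℓ ⊕ ℓ'` if the planes are transverse). -/
def planeProduct {n : ℕ} {l l' : Submodule ℝ (PhaseSpace n)} (X : Set l) (Y : Set l') :
    Set (PhaseSpace n) :=
  {z | ∃ x ∈ X, ∃ y ∈ Y, (x : PhaseSpace n) + (y : PhaseSpace n) = z}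

/-- `E` is the John ellipsoid of `Ω`: the unique ellipsoid of maximal volume among all
ellipsoids (with arbitrary centers) contained in `Ω`. -/
def IsJohnEllipsoid {n : ℕ} (Ω E : Set (PhaseSpace n)) : Prop :=
  IsEllipsoid E ∧ E ⊆ Ω ∧
    (∀ E' : Set (PhaseSpace n), IsEllipsoid E' → E' ⊆ Ω →
      MeasureTheory.volume E' ≤ MeasureTheory.volume E) ∧
    (∀ E' : Set (PhaseSpace n), IsEllipsoid E' → E' ⊆ Ω →
      MeasureTheory.volume E' = MeasureTheory.volume E → E' = E)

/-- The minimal linear symplectic capacity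
`sup {π R² | S (B²ⁿ(z₀, R)) ⊆ Ω, S ∈ Sp(n), z₀ ∈ ℝ²ⁿ, R ≥ 0}`, with values in `[0, ∞]`. -/
noncomputable def cMinLin {n : ℕ} (Ω : Set (PhaseSpace n)) : ℝ≥0∞ :=
  sSup {c | ∃ S ∈ Sp n, ∃ (z₀ : PhaseSpace n) (R : ℝ), 0 ≤ R ∧
    S '' Metric.closedBall z₀ R ⊆ Ω ∧ c = ENNReal.ofReal (Real.pi * R ^ 2)}

end LagrangianPolarity

/-! Everything reduces to one model. Linear coordinates turn $X_\ell$ into the unit ball of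
$\mathbb{R}^n_x$; since $\omega$ pairs $\ell$ and $\ell'$ perfectly, there are dual coordinates on
$\ell'$, in which the polar dual is the unit ball of $\mathbb{R}^n_p$. Together they form a
symplectic map carrying the bidisc onto the product (`exists_symplectic_image_unitBidisc`).

The bidisc lies between the unit ball and the cube $[-1,1]^{2n}$, so it suffices that the ball is
the John ellipsoid of the cube. For an ellipsoid $c+T(B)$ in the cube, every row of $T$ has norm at
most 1, so $TT^\dagger$ has trace at most the dimension, and AM-GM bounds its determinant
(`volume_le_of_isEllipsoid_of_subset_cube`).

Linear automorphisms transport John ellipsoids, which gives (i). Symplectic maps preserve volume, so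
a symplectic ball in the product is an ellipsoid no larger than the unit ball, which gives (ii). -/

namespace LagrangianPolarity

open Module MeasureTheory

/-! ### Ellipsoids of maximal volume in a cube -/

section EuclideanEllipsoids

theorem exists_linearEquiv_norm_sq_eq {V ι : Type*} [AddCommGroup V] [Module ℝ V]
    [FiniteDimensional ℝ V] [Fintype ι] (hι : finrank ℝ V = Fintype.card ι)
    {Q : QuadraticForm ℝ V} (hQ : Q.PosDef) :
    ∃ φ : V ≃ₗ[ℝ] EuclideanSpace ℝ ι, ∀ z, Q z = ‖φ z‖ ^ 2 := by
  obtain ⟨w, hw, ⟨e⟩⟩ := Q.equivalent_one_zero_neg_one_weighted_sum_squared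
  -- Sylvester's law leaves weights 0, 1 and -1; positivity on the basis vectors excludes all but 1.
  have hw1 : ∀ i, w i = 1 := by
    intro i
    have h0 : e.symm (Pi.single i 1) ≠ 0 := by
      intro h
      have := congrArg e h
      rw [e.apply_symm_apply, map_zero] at this
      simpa using congrFun this i
    have hpos := hQ _ h0
    rw [e.symm.map_app, QuadraticMap.weightedSumSquares_apply] at hpos
    simp [Pi.single_apply] at hpos
    rcases hw i with h | h | h <;> first | exact h | (rw [h] at hpos; norm_num at hpos)
  let σ : Fin (finrank ℝ V) ≃ ι := (finCongr hι).trans (Fintype.equivFin ι).symm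
  refine ⟨(e.toLinearEquiv.trans (LinearEquiv.funCongrLeft ℝ ℝ σ.symm)).trans
    (WithLp.linearEquiv 2 ℝ (ι → ℝ)).symm, fun z => ?_⟩
  rw [← e.map_app, QuadraticMap.weightedSumSquares_apply, EuclideanSpace.real_norm_sq_eq,
    ← Equiv.sum_comp σ]
  simp [hw1, sq]

theorem isEllipsoid_image_closedBall {E F : Type*} [NormedAddCommGroup E]
    [InnerProductSpace ℝ E] [AddCommGroup F] [Module ℝ F] (T : E ≃ₗ[ℝ] F) (c : F) :
    IsEllipsoid ((fun z => c + T z) '' Metric.closedBall (0 : E) 1) := by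
  refine ⟨c, (LinearMap.BilinMap.toQuadraticMap (innerₗ E)).comp T.symm.toLinearMap, fun x hx => ?_,
    ?_⟩
  · have : T.symm x ≠ 0 := by simpa using hx
    simpa [sq_pos_iff] using this
  · ext z
    simp only [Set.mem_image, Metric.mem_closedBall, dist_zero_right, Set.mem_ofPred_eq]
    constructor
    · rintro ⟨y, hy, rfl⟩
      simpa [real_inner_self_eq_norm_sq] using hy
    · intro h
      refine ⟨T.symm (z - c), ?_, by simp⟩
      rw [QuadraticMap.comp_apply, LinearMap.BilinMap.toQuadraticMap_apply, innerₗ_apply_apply,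
        real_inner_self_eq_norm_sq] at h
      exact (sq_le_one_iff₀ (norm_nonneg _)).1 h

variable {E : Type*} [NormedAddCommGroup E] [InnerProductSpace ℝ E] [FiniteDimensional ℝ E]

theorem IsEllipsoid.exists_eq_image_closedBall {X : Set E} (hX : IsEllipsoid X) :
    ∃ (T : E ≃ₗ[ℝ] E) (c : E), X = (fun z => c + T z) '' Metric.closedBall (0 : E) 1 := by
  obtain ⟨c, Q, hQ, rfl⟩ := hX
  obtain ⟨φ, hφ⟩ := exists_linearEquiv_norm_sq_eq (ι := Fin (finrank ℝ E)) (by simp) hQ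
  refine ⟨φ.trans (stdOrthonormalBasis ℝ E).repr.symm.toLinearEquiv |>.symm, c, ?_⟩
  ext z
  simp only [Set.mem_image, Metric.mem_closedBall, dist_zero_right, Set.mem_ofPred_eq, hφ]
  constructor
  · intro h
    refine ⟨(stdOrthonormalBasis ℝ E).repr.symm (φ (z - c)), ?_, by simp⟩
    rw [LinearIsometryEquiv.norm_map]
    nlinarith [norm_nonneg (φ (z - c))]
  · rintro ⟨y, hy, rfl⟩
    simpa using hy

theorem volume_image_affine [MeasurableSpace E] [BorelSpace E] (T : E →ₗ[ℝ] E) (c : E)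
    (s : Set E) :
    volume ((fun z => c + T z) '' s) = ENNReal.ofReal |LinearMap.det T| * volume s := by
  rw [← Measure.addHaar_image_linearMap, ← measure_preimage_add volume c]
  congr 1
  ext z
  simp

/-- An ellipsoid `c + T(B)` contained in the slab `|⟨e, z⟩| ≤ 1` has half-width `‖T† e‖` in the
direction of `e`, which leaves only `1 - ‖T† e‖` of room for its center. -/
theorem norm_adjoint_add_abs_inner_le {T : E →ₗ[ℝ] E} {c e : E}
    (h : ∀ z ∈ Metric.closedBall (0 : E) 1, |inner ℝ e (c + T z)| ≤ 1) :
    ‖T.adjoint e‖ + |inner ℝ e c| ≤ 1 := by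
  set u := T.adjoint e with hu
  -- The functional `⟨e, T z⟩ = ⟨u, z⟩` is extremal on the ball at `±u/‖u‖`. If `u = 0`, the
  -- convention `0⁻¹ = 0` makes both points the origin, and the estimates still hold.
  have hz : ‖u‖⁻¹ • u ∈ Metric.closedBall (0 : E) 1 := by
    rw [mem_closedBall_zero_iff, norm_smul, norm_inv, norm_norm]
    exact inv_mul_le_one
  have hz' : -(‖u‖⁻¹ • u) ∈ Metric.closedBall (0 : E) 1 := by
    rwa [mem_closedBall_zero_iff, norm_neg, ← mem_closedBall_zero_iff]
  have hin : inner ℝ e (T (‖u‖⁻¹ • u)) = ‖u‖ := by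
    rw [← LinearMap.adjoint_inner_left, ← hu, inner_smul_right, real_inner_self_eq_norm_sq]
    by_cases h0 : ‖u‖ = 0
    · simp [h0]
    · field_simp
  have h1 := h _ hz
  have h2 := h _ hz'
  rw [inner_add_right, hin, abs_le] at h1
  rw [inner_add_right, map_neg, inner_neg_right, hin, abs_le] at h2
  have : |inner ℝ e c| ≤ 1 - ‖u‖ := abs_le.2 ⟨by linarith, by linarith⟩
  linarith

theorem det_adjoint (T : E →ₗ[ℝ] E) : LinearMap.det T.adjoint = LinearMap.det T := by
  let b := stdOrthonormalBasis ℝ E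
  rw [← LinearMap.det_toMatrix b.toBasis, LinearMap.toMatrix_adjoint, Matrix.det_conjTranspose,
    LinearMap.det_toMatrix, star_trivial]

/-- The AM-GM inequality for the eigenvalues of `T T†`, with its equality case. -/
theorem abs_det_le_one_of_norm_adjoint_le {ι : Type*} [Fintype ι] (b : OrthonormalBasis ι ℝ E)
    {T : E →ₗ[ℝ] E} (hT : LinearMap.det T ≠ 0) (h : ∀ i, ‖T.adjoint (b i)‖ ≤ 1) :
    |LinearMap.det T| ≤ 1 ∧ (|LinearMap.det T| = 1 → T ∘ₗ T.adjoint = LinearMap.id) := by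
  set P := T ∘ₗ T.adjoint with hP
  have hsym : P.IsSymmetric := T.isSymmetric_self_comp_adjoint
  have hdet : LinearMap.det P = LinearMap.det T ^ 2 := by
    rw [hP, LinearMap.det_comp, det_adjoint, sq]
  have htr : LinearMap.trace ℝ E P ≤ finrank ℝ E := by
    rw [LinearMap.trace_eq_sum_inner P b, finrank_eq_card_basis b.toBasis]
    calc ∑ i, inner ℝ (b i) (P (b i)) ≤ ∑ _i : ι, (1 : ℝ) := by
          refine Finset.sum_le_sum fun i _ => ?_
          rw [hP, LinearMap.comp_apply, ← LinearMap.adjoint_inner_left, real_inner_self_eq_norm_sq]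
          exact pow_le_one₀ (norm_nonneg _) (h i)
      _ = _ := by simp
  set μ := hsym.eigenvalues rfl with hμ
  have hnonneg : ∀ i, 0 ≤ μ i := by
    intro i
    have h1 : inner ℝ (hsym.eigenvectorBasis rfl i) (P (hsym.eigenvectorBasis rfl i)) = μ i := by
      rw [hsym.apply_eigenvectorBasis, inner_smul_right]
      simp [hμ]
    rw [← h1]
    change 0 ≤ inner ℝ _ (T (T.adjoint _))
    rw [← LinearMap.adjoint_inner_left]
    exact real_inner_self_nonneg
  have hprod : LinearMap.det T ^ 2 = ∏ i, μ i := by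
    rw [← hdet, hsym.det_eq_prod_eigenvalues rfl]; simp [hμ]
  have hpos : ∀ i, 0 < μ i := by
    intro i
    refine (hnonneg i).lt_of_ne' fun h0 => ?_
    have := Finset.prod_eq_zero (Finset.mem_univ i) h0
    rw [← hprod] at this
    exact hT (pow_eq_zero_iff two_ne_zero |>.1 this)
  have hsum : ∑ i, (μ i - 1) ≤ 0 := by
    rw [hsym.trace_eq_sum_eigenvalues rfl] at htr
    simpa [Finset.sum_sub_distrib] using htr
  have hlog : Real.log (LinearMap.det T ^ 2) = ∑ i, Real.log (μ i) := by
    rw [hprod, Real.log_prod fun i _ => (hpos i).ne']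
  -- AM-GM by tangent line: `log t ≤ t - 1`, with equality only at `t = 1`.
  have hle : ∀ i ∈ Finset.univ, Real.log (μ i) ≤ μ i - 1 := fun i _ =>
    Real.log_le_sub_one_of_pos (hpos i)
  have hdpos : 0 < LinearMap.det T ^ 2 := by positivity
  refine ⟨?_, fun h1 => ?_⟩
  · rw [← sq_le_one_iff_abs_le_one, ← Real.log_nonpos_iff hdpos.le, hlog]
    exact (Finset.sum_le_sum hle).trans hsum
  · rw [← sq_abs, h1, one_pow, Real.log_one] at hlog
    have heq : ∑ i, Real.log (μ i) = ∑ i, (μ i - 1) :=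
      le_antisymm (Finset.sum_le_sum hle) (hlog ▸ hsum)
    have hone : ∀ i, μ i = 1 := by
      intro i
      by_contra hne
      have h2 := (Finset.sum_eq_sum_iff_of_le hle).1 heq i (Finset.mem_univ i)
      exact (Real.log_lt_sub_one_of_pos (hpos i) hne).ne h2
    refine (hsym.eigenvectorBasis rfl).toBasis.ext fun i => ?_
    simp only [OrthonormalBasis.coe_toBasis, LinearMap.id_apply]
    rw [hsym.apply_eigenvectorBasis]
    have := hone i
    rw [hμ] at this
    simp [this]

theorem volume_le_of_isEllipsoid_of_subset_cube [MeasurableSpace E] [BorelSpace E]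
    {ι : Type*} [Fintype ι] (b : OrthonormalBasis ι ℝ E) {X : Set E} (hX : IsEllipsoid X)
    (hsub : ∀ z ∈ X, ∀ i, |inner ℝ (b i) z| ≤ 1) :
    volume X ≤ volume (Metric.closedBall (0 : E) 1) ∧
      (volume X = volume (Metric.closedBall (0 : E) 1) → X = Metric.closedBall 0 1) := by
  obtain ⟨T, c, rfl⟩ := hX.exists_eq_image_closedBall
  have hrow : ∀ i, ‖T.toLinearMap.adjoint (b i)‖ + |inner ℝ (b i) c| ≤ 1 := fun i =>
    norm_adjoint_add_abs_inner_le fun z hz => hsub _ ⟨z, hz, rfl⟩ i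
  obtain ⟨hle, heq⟩ := abs_det_le_one_of_norm_adjoint_le b (T := T.toLinearMap)
    (LinearEquiv.isUnit_det' T).ne_zero
    (fun i => by linarith [hrow i, abs_nonneg (inner ℝ (b i) c)])
  have hvol := volume_image_affine T.toLinearMap c (Metric.closedBall 0 1)
  simp only [LinearEquiv.coe_coe] at hvol
  rw [hvol]
  have hB0 : volume (Metric.closedBall (0 : E) 1) ≠ 0 :=
    (Metric.measure_closedBall_pos _ _ one_pos).ne'
  have hBtop : volume (Metric.closedBall (0 : E) 1) ≠ ∞ := measure_closedBall_lt_top.ne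
  refine ⟨mul_le_of_le_one_left' (ENNReal.ofReal_le_one.2 hle), fun h => ?_⟩
  have h1 : |LinearMap.det T.toLinearMap| = 1 := by
    rw [← ENNReal.ofReal_eq_one]
    exact (ENNReal.mul_eq_right hB0 hBtop).1 h
  have hid := heq h1
  have hnorm : ∀ z, ‖T.toLinearMap.adjoint z‖ = ‖z‖ := by
    intro z
    rw [← sq_eq_sq₀ (norm_nonneg _) (norm_nonneg _), ← real_inner_self_eq_norm_sq,
      ← real_inner_self_eq_norm_sq, LinearMap.adjoint_inner_left]
    exact congrArg (inner ℝ z) (LinearMap.congr_fun hid z)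
  -- The adjoint is now an isometry, so each slab is filled completely and the center has no room to
  -- move.
  have hc : c = 0 := by
    refine b.repr.injective (PiLp.ext fun i => ?_)
    have := hrow i
    rw [hnorm, b.norm_eq_one] at this
    rw [map_zero, PiLp.zero_apply, b.repr_apply_apply, ← abs_nonpos_iff]
    linarith
  subst hc
  have hTT : ∀ z, T (T.toLinearMap.adjoint z) = z := LinearMap.congr_fun hid
  ext z
  simp only [zero_add, Set.mem_image, mem_closedBall_zero_iff]
  constructor
  · rintro ⟨y, hy, rfl⟩
    rwa [← hnorm, ← T.injective.eq_iff.1 (hTT (T y)).symm]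
  · exact fun hz => ⟨_, (hnorm z).trans_le hz, hTT z⟩

end EuclideanEllipsoids

/-! ### The symplectic form and its determinant -/

section SymplecticForm

variable {n : ℕ}

/-- The standard complex structure `(x, p) ↦ (p, -x)`, which represents `omega`. -/
noncomputable def complexStructure (n : ℕ) : PhaseSpace n →ₗ[ℝ] PhaseSpace n where
  toFun z := WithLp.toLp 2 (Sum.elim (fun j => z (Sum.inr j)) (fun j => -z (Sum.inl j)))
  map_add' z z' := by
    ext (j | j) <;> simp [add_comm]
  map_smul' a z := by
    ext (j | j) <;> simp

theorem omega_eq_inner (z z' : PhaseSpace n) : omega z z' = inner ℝ (complexStructure n z) z' := by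
  simp [omega, complexStructure, PiLp.inner_apply, Fintype.sum_sum_type,
    Finset.sum_add_distrib, sub_eq_add_neg, mul_comm]

theorem det_complexStructure_ne_zero (n : ℕ) : LinearMap.det (complexStructure n) ≠ 0 := by
  have h : complexStructure n ∘ₗ complexStructure n = (-1 : ℝ) • LinearMap.id := by
    ext z (j | j) <;> simp [complexStructure]
  intro h0
  have := congrArg LinearMap.det h
  rw [LinearMap.det_comp, h0, zero_mul, LinearMap.det_smul, LinearMap.det_id, mul_one] at this
  exact pow_ne_zero _ (by norm_num) this.symm

/-- Invariance of $\omega$ reads $S^\dagger J S = J$; take determinants and cancel $\det J \ne 0$.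
-/
theorem abs_det_eq_one_of_mem_Sp {S : PhaseSpace n ≃ₗ[ℝ] PhaseSpace n} (hS : S ∈ Sp n) :
    |LinearMap.det S.toLinearMap| = 1 := by
  have h : S.toLinearMap.adjoint ∘ₗ complexStructure n ∘ₗ S.toLinearMap = complexStructure n := by
    refine LinearMap.ext fun z => ext_inner_right ℝ fun z' => ?_
    rw [LinearMap.comp_apply, LinearMap.adjoint_inner_left, ← omega_eq_inner]
    exact (omega_eq_inner _ _).symm.trans (hS z z')
  have := congrArg LinearMap.det h
  rw [LinearMap.det_comp, LinearMap.det_comp, det_adjoint] at this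
  rw [← pow_eq_one_iff_of_nonneg (abs_nonneg _) two_ne_zero, sq_abs]
  refine mul_right_cancel₀ (det_complexStructure_ne_zero n) ?_
  linear_combination this

theorem omega_add_left (a b c : PhaseSpace n) : omega (a + b) c = omega a c + omega b c := by
  simp only [omega_eq_inner, map_add, inner_add_left]

theorem omega_add_right (a b c : PhaseSpace n) : omega a (b + c) = omega a b + omega a c := by
  simp only [omega_eq_inner, inner_add_right]

theorem omega_comm (a b : PhaseSpace n) : omega a b = -omega b a := by
  simp only [omega, ← Finset.sum_neg_distrib]
  exact Finset.sum_congr rfl fun j _ => by ring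

theorem eq_zero_of_forall_omega_eq_zero {z : PhaseSpace n} (h : ∀ z', omega z z' = 0) : z = 0 := by
  have h0 : complexStructure n z = 0 :=
    ext_inner_right ℝ fun z' => by rw [← omega_eq_inner, h, inner_zero_left]
  exact (LinearMap.equivOfDetNeZero _ (det_complexStructure_ne_zero n)).injective
    (h0.trans (map_zero _).symm)

end SymplecticForm

/-! ### Normal form for a pair of transverse Lagrangian planes -/

section TransverseLagrangians

variable {n : ℕ} {l l' : Submodule ℝ (PhaseSpace n)}

theorem sup_eq_top_of_areTransverse (hl : IsLagrangianPlane l) (hl' : IsLagrangianPlane l')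
    (h : AreTransverse l l') : l ⊔ l' = ⊤ := by
  refine Submodule.eq_top_of_disjoint l l' ?_ (disjoint_iff.2 h)
  rw [hl.1, hl'.1]
  simp

/-- Coordinates on `ℓ` extend to dual coordinates on a transverse Lagrangian plane `ℓ'`. -/
theorem exists_dual_coordinates (hl : IsLagrangianPlane l) (hl' : IsLagrangianPlane l')
    (h : AreTransverse l l') (φ : l ≃ₗ[ℝ] EuclideanSpace ℝ (Fin n)) :
    ∃ ψ : l' ≃ₗ[ℝ] EuclideanSpace ℝ (Fin n), ∀ (z : l) (z' : l'),
      omega (z' : PhaseSpace n) (z : PhaseSpace n) = inner ℝ (ψ z') (φ z) := by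
  let B : l' →ₗ[ℝ] l →ₗ[ℝ] ℝ :=
    ((innerₗ (PhaseSpace n)).compl₁₂ (complexStructure n ∘ₗ l'.subtype) l.subtype)
  have hB : ∀ z' z, B z' z = omega (z' : PhaseSpace n) (z : PhaseSpace n) := fun z' z =>
    (omega_eq_inner _ _).symm
  let L : l' →ₗ[ℝ] EuclideanSpace ℝ (Fin n) :=
    (WithLp.linearEquiv 2 ℝ (Fin n → ℝ)).symm.toLinearMap ∘ₗ
      LinearMap.pi fun i => B.flip (φ.symm (EuclideanSpace.single i 1))
  have hL : ∀ z' z, inner ℝ (L z') (φ z) = B z' z := by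
    intro z' z
    have hz : z = ∑ i, φ z i • φ.symm (EuclideanSpace.single i 1) := by
      apply φ.injective
      ext j
      simp [Pi.single_apply]
    conv_rhs => rw [hz]
    simp [L, PiLp.inner_apply]
  -- A vector of `l'` pairing to zero with `l` also pairs to zero with the isotropic `l'`, hence
  -- with the whole space.
  have hinj : Function.Injective L := by
    rw [injective_iff_map_eq_zero]
    intro z' h0
    ext1
    refine eq_zero_of_forall_omega_eq_zero fun w => ?_
    obtain ⟨a, ha, b, hb, rfl⟩ := Submodule.mem_sup.1
      ((sup_eq_top_of_areTransverse hl hl' h).symm ▸ Submodule.mem_top : w ∈ l ⊔ l')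
    rw [omega_add_right, hl'.2 _ z'.2 _ hb, add_zero, ← hB z' ⟨a, ha⟩, ← hL, h0, inner_zero_left]
  refine ⟨L.linearEquivOfInjective hinj (by simp [hl'.1]), fun z z' => ?_⟩
  rw [LinearMap.linearEquivOfInjective_apply, hL, hB]

/-- The product of the closed unit balls of `ℝⁿ_x` and `ℝⁿ_p`. -/
def unitBidisc (n : ℕ) : Set (PhaseSpace n) :=
  {z | ∑ j, z (Sum.inl j) ^ 2 ≤ 1 ∧ ∑ j, z (Sum.inr j) ^ 2 ≤ 1}

theorem forall_inner_le_one_iff {E : Type*} [NormedAddCommGroup E] [InnerProductSpace ℝ E] (u : E) :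
    (∀ v, ‖v‖ ≤ 1 → inner ℝ u v ≤ 1) ↔ ‖u‖ ≤ 1 := by
  constructor
  · intro h
    have h1 := h (‖u‖⁻¹ • u) (by
      rw [norm_smul, norm_inv, norm_norm]
      exact inv_mul_le_one)
    rw [inner_smul_right, real_inner_self_eq_norm_sq] at h1
    by_cases h0 : ‖u‖ = 0
    · simp [h0]
    · field_simp at h1
      exact h1
  · intro h v hv
    exact (real_inner_le_norm u v).trans (mul_le_one₀ h (norm_nonneg _) hv)

/-- A symplectic normal form for the product of an ellipsoid and its Lagrangian polar dual. -/
theorem exists_symplectic_image_unitBidisc (hl : IsLagrangianPlane l) (hl' : IsLagrangianPlane l')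
    (h : AreTransverse l l') {X : Set l} (hX : IsCenteredEllipsoid X) :
    ∃ S ∈ Sp n, planeProduct X (lagrangianPolarDual X l') = S '' unitBidisc n := by
  obtain ⟨Q, hQ, rfl⟩ := hX
  obtain ⟨φ, hφ⟩ := exists_linearEquiv_norm_sq_eq (ι := Fin n) (by simp [hl.1]) hQ
  obtain ⟨ψ, hψ⟩ := exists_dual_coordinates hl hl' h φ
  let x : PhaseSpace n →ₗ[ℝ] EuclideanSpace ℝ (Fin n) :=
    (WithLp.linearEquiv 2 ℝ (Fin n → ℝ)).symm.toLinearMap ∘ₗ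
      LinearMap.funLeft ℝ ℝ Sum.inl ∘ₗ (WithLp.linearEquiv 2 ℝ (Fin n ⊕ Fin n → ℝ)).toLinearMap
  let p : PhaseSpace n →ₗ[ℝ] EuclideanSpace ℝ (Fin n) :=
    (WithLp.linearEquiv 2 ℝ (Fin n → ℝ)).symm.toLinearMap ∘ₗ
      LinearMap.funLeft ℝ ℝ Sum.inr ∘ₗ (WithLp.linearEquiv 2 ℝ (Fin n ⊕ Fin n → ℝ)).toLinearMap
  have hx : ∀ z j, x z j = z (Sum.inl j) := fun z j => rfl
  have hp : ∀ z j, p z j = z (Sum.inr j) := fun z j => rfl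
  let F : PhaseSpace n →ₗ[ℝ] PhaseSpace n :=
    l.subtype ∘ₗ φ.symm.toLinearMap ∘ₗ x + l'.subtype ∘ₗ ψ.symm.toLinearMap ∘ₗ p
  have hF : ∀ z, F z = (φ.symm (x z) : PhaseSpace n) + (ψ.symm (p z) : PhaseSpace n) :=
    fun z => rfl
  have homega : ∀ z z', omega (F z) (F z') = omega z z' := by
    intro z z'
    rw [hF, hF, omega_add_left, omega_add_right, omega_add_right,
      hl.2 _ (φ.symm _).2 _ (φ.symm _).2, hl'.2 _ (ψ.symm _).2 _ (ψ.symm _).2,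
      omega_comm (φ.symm _ : PhaseSpace n), hψ, hψ]
    simp only [LinearEquiv.apply_symm_apply, PiLp.inner_apply, hx, hp, omega,
      Finset.sum_sub_distrib]
    simp [mul_comm]
    ring
  have hinj : Function.Injective F := by
    rw [injective_iff_map_eq_zero]
    intro z hz
    refine eq_zero_of_forall_omega_eq_zero fun z' => ?_
    rw [← homega, hz, omega_eq_inner, map_zero, inner_zero_left]
  have hpolar : ∀ z' : l', z' ∈ lagrangianPolarDual {z : l | Q z ≤ 1} l' ↔ ‖ψ z'‖ ≤ 1 := by
    intro z'
    -- The polar dual uses `ω(z, z') = -⟨ψ z', φ z⟩`; the sign is harmless because the ball is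
    -- symmetric.
    rw [← norm_neg, ← forall_inner_le_one_iff]
    constructor
    · intro hz v hv
      have h1 := hz (φ.symm v) (by
        simpa [hφ] using hv)
      rw [omega_comm, hψ, LinearEquiv.apply_symm_apply] at h1
      rwa [inner_neg_left]
    · intro hz z hzQ
      rw [omega_comm, hψ, ← inner_neg_left]
      refine hz _ ((sq_le_one_iff₀ (norm_nonneg _)).1 ?_)
      rw [← hφ]
      exact hzQ
  have hbidisc : ∀ z, z ∈ unitBidisc n ↔ ‖x z‖ ≤ 1 ∧ ‖p z‖ ≤ 1 := by
    intro z
    rw [← sq_le_one_iff₀ (norm_nonneg (x z)), ← sq_le_one_iff₀ (norm_nonneg (p z)),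
      EuclideanSpace.real_norm_sq_eq, EuclideanSpace.real_norm_sq_eq]
    exact Iff.rfl
  refine ⟨LinearEquiv.ofInjectiveEndo F hinj, homega, ?_⟩
  ext w
  simp only [LinearEquiv.coe_ofInjectiveEndo, Set.mem_image, hbidisc, hF]
  constructor
  · rintro ⟨a, ha, b, hb, rfl⟩
    refine ⟨WithLp.toLp 2 (Sum.elim (φ a) (ψ b)), ⟨?_, (hpolar b).1 hb⟩, ?_⟩
    · refine (sq_le_one_iff₀ (norm_nonneg _)).1 ?_
      exact (hφ a).symm.trans_le ha
    · exact congrArg₂ (fun (s : l) (t : l') => (s : PhaseSpace n) + (t : PhaseSpace n))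
        (φ.symm_apply_apply a) (ψ.symm_apply_apply b)
  · rintro ⟨z, ⟨h1, h2⟩, rfl⟩
    refine ⟨φ.symm (x z), ?_, ψ.symm (p z), ?_, rfl⟩
    · change Q _ ≤ 1
      rw [hφ, LinearEquiv.apply_symm_apply]
      exact pow_le_one₀ (norm_nonneg _) h1
    · rwa [hpolar, LinearEquiv.apply_symm_apply]

end TransverseLagrangians

/-! ### John ellipsoids and the linear capacity -/

section JohnEllipsoid

variable {n : ℕ}

theorem isJohnEllipsoid_unitBidisc (n : ℕ) :
    IsJohnEllipsoid (unitBidisc n) (Metric.closedBall 0 1) := by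
  have hcube : ∀ z ∈ unitBidisc n, ∀ i,
      |inner ℝ (EuclideanSpace.basisFun (Fin n ⊕ Fin n) ℝ i) z| ≤ 1 := by
    rintro z ⟨h1, h2⟩ i
    rw [← OrthonormalBasis.repr_apply_apply, EuclideanSpace.basisFun_repr,
      ← sq_le_one_iff_abs_le_one]
    rcases i with j | j
    · exact (Finset.single_le_sum (f := fun j => z (Sum.inl j) ^ 2) (fun _ _ => sq_nonneg _)
        (Finset.mem_univ j)).trans h1
    · exact (Finset.single_le_sum (f := fun j => z (Sum.inr j) ^ 2) (fun _ _ => sq_nonneg _)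
        (Finset.mem_univ j)).trans h2
  refine ⟨?_, ?_, fun E hE hsub => ?_, fun E hE hsub => ?_⟩
  · simpa using isEllipsoid_image_closedBall (LinearEquiv.refl ℝ (PhaseSpace n)) 0
  · intro z hz
    rw [mem_closedBall_zero_iff, ← sq_le_one_iff₀ (norm_nonneg _), EuclideanSpace.real_norm_sq_eq,
      Fintype.sum_sum_type] at hz
    have h1 : 0 ≤ ∑ j, z (Sum.inl j) ^ 2 := Finset.sum_nonneg fun _ _ => sq_nonneg _
    have h2 : 0 ≤ ∑ j, z (Sum.inr j) ^ 2 := Finset.sum_nonneg fun _ _ => sq_nonneg _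
    exact ⟨by linarith, by linarith⟩
  · exact (volume_le_of_isEllipsoid_of_subset_cube _ hE fun z hz => hcube z (hsub hz)).1
  · exact (volume_le_of_isEllipsoid_of_subset_cube _ hE fun z hz => hcube z (hsub hz)).2

theorem IsEllipsoid.image {V W : Type*} [AddCommGroup V] [Module ℝ V] [AddCommGroup W] [Module ℝ W]
    {E : Set V} (hE : IsEllipsoid E) (T : V ≃ₗ[ℝ] W) : IsEllipsoid (T '' E) := by
  obtain ⟨c, Q, hQ, rfl⟩ := hE
  refine ⟨T c, Q.comp T.symm.toLinearMap, fun x hx => ?_, ?_⟩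
  · exact hQ _ (by simpa using hx)
  · ext z
    rw [← LinearEquiv.coe_toEquiv, Equiv.image_eq_preimage_symm]
    simp

/-- A linear automorphism permutes ellipsoids and scales all volumes by the same nonzero factor. -/
theorem IsJohnEllipsoid.image {Ω E : Set (PhaseSpace n)} (h : IsJohnEllipsoid Ω E)
    (T : PhaseSpace n ≃ₗ[ℝ] PhaseSpace n) : IsJohnEllipsoid (T '' Ω) (T '' E) := by
  obtain ⟨h1, h2, h3, h4⟩ := h
  have hvol : ∀ s : Set (PhaseSpace n),
      volume (T '' s) = ENNReal.ofReal |LinearMap.det T.toLinearMap| * volume s :=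
    Measure.addHaar_image_linearMap volume T.toLinearMap
  have hpre : ∀ {E' : Set (PhaseSpace n)}, IsEllipsoid E' → E' ⊆ T '' Ω →
      ∃ E'', IsEllipsoid E'' ∧ E'' ⊆ Ω ∧ E' = T '' E'' := by
    intro E' hE' hsub
    refine ⟨T.symm '' E', hE'.image T.symm, ?_, by simp [Set.image_image]⟩
    rintro _ ⟨z, hz, rfl⟩
    obtain ⟨w, hw, rfl⟩ := hsub hz
    simpa using hw
  refine ⟨h1.image T, Set.image_mono h2, fun E' hE' hsub => ?_, fun E' hE' hsub hv => ?_⟩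
  · obtain ⟨E'', hell, hs, rfl⟩ := hpre hE' hsub
    rw [hvol, hvol]
    exact mul_le_mul_right (h3 _ hell hs) _
  · obtain ⟨E'', hell, hs, rfl⟩ := hpre hE' hsub
    rw [hvol, hvol] at hv
    refine congrArg _ (h4 _ hell hs ((ENNReal.mul_right_inj ?_ ENNReal.ofReal_ne_top).1 hv))
    exact (ENNReal.ofReal_pos.2 (abs_pos.2 (LinearEquiv.isUnit_det' T).ne_zero)).ne'

theorem volume_image_of_mem_Sp {S : PhaseSpace n ≃ₗ[ℝ] PhaseSpace n} (hS : S ∈ Sp n)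
    (s : Set (PhaseSpace n)) : volume (S '' s) = volume s := by
  have h := Measure.addHaar_image_linearMap volume S.toLinearMap s
  rwa [abs_det_eq_one_of_mem_Sp hS, ENNReal.ofReal_one, one_mul] at h

theorem cMinLin_eq_pi_of_isJohnEllipsoid (hn : 1 ≤ n) {Ω : Set (PhaseSpace n)}
    {S : PhaseSpace n ≃ₗ[ℝ] PhaseSpace n} (hS : S ∈ Sp n)
    (h : IsJohnEllipsoid Ω (S '' Metric.closedBall 0 1)) :
    cMinLin Ω = ENNReal.ofReal Real.pi := by
  refine le_antisymm (sSup_le ?_) (le_sSup ⟨S, hS, 0, 1, zero_le_one, h.2.1, by simp⟩)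
  rintro _ ⟨T, hT, z₀, R, hR, hsub, rfl⟩
  refine ENNReal.ofReal_le_ofReal (mul_le_of_le_one_right Real.pi_pos.le ?_)
  refine pow_le_one₀ hR ?_
  -- A ball of radius 0 is not a nondegenerate ellipsoid, so maximality cannot be applied to it.
  rcases hR.eq_or_lt with rfl | hRpos
  · exact zero_le_one
  have hball : IsEllipsoid (Metric.closedBall z₀ R) := by
    have := isEllipsoid_image_closedBall (LinearEquiv.smulOfNeZero ℝ (PhaseSpace n) R hRpos.ne') z₀
    convert this using 1
    have h2 := affinity_unitClosedBall (E := PhaseSpace n) hR z₀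
    rw [← h2]
    ext z
    simp [Set.mem_vadd_set, Set.mem_smul_set]
  have hle := h.2.2.1 _ (hball.image T) hsub
  rw [volume_image_of_mem_Sp hT, volume_image_of_mem_Sp hS,
    Measure.addHaar_closedBall' _ _ hR] at hle
  have hpow : ENNReal.ofReal (R ^ finrank ℝ (PhaseSpace n)) ≤ 1 := by
    refine (ENNReal.mul_le_mul_iff_left
      (Metric.measure_closedBall_pos volume (0 : PhaseSpace n) one_pos).ne'
      measure_closedBall_lt_top.ne).1 ?_
    rwa [one_mul]
  rw [ENNReal.ofReal_le_one] at hpow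
  -- The exponent `2n` is nonzero because `1 ≤ n`; otherwise volume would not control the radius.
  refine (pow_le_one_iff_of_nonneg hR ?_).1 hpow
  simp
  omega

end JohnEllipsoid

end LagrangianPolarity

theorem mainTheorem3 (n : ℕ) (hn : 1 ≤ n)
    (l l' : Submodule ℝ (LagrangianPolarity.PhaseSpace n))
    (hl : LagrangianPolarity.IsLagrangianPlane l)
    (hl' : LagrangianPolarity.IsLagrangianPlane l')
    (htrans : LagrangianPolarity.AreTransverse l l')
    (X : Set l) (hX : LagrangianPolarity.IsCenteredEllipsoid X) :
    (∃ S ∈ LagrangianPolarity.Sp n,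
      LagrangianPolarity.IsJohnEllipsoid
        (LagrangianPolarity.planeProduct X (LagrangianPolarity.lagrangianPolarDual X l'))
        (S '' Metric.closedBall (0 : LagrangianPolarity.PhaseSpace n) 1)) ∧
    LagrangianPolarity.cMinLin
        (LagrangianPolarity.planeProduct X (LagrangianPolarity.lagrangianPolarDual X l')) =
      ENNReal.ofReal Real.pi := by
  obtain ⟨S, hS, hprod⟩ :=
    LagrangianPolarity.exists_symplectic_image_unitBidisc hl hl' htrans hX
  have hJohn := (LagrangianPolarity.isJohnEllipsoid_unitBidisc n).image S
  rw [← hprod] at hJohn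
  exact ⟨⟨S, hS, hJohn⟩, LagrangianPolarity.cMinLin_eq_pi_of_isJohnEllipsoid hn hS hJohn⟩
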